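/- Let $n\ge 1$ and let $x$ be uniformly distributed on $\{-1,1\}^n$. For $f:\{-1,1\}^n\to\mathbb{R}$ put $D_jf(x)=\tfrac12\big(f(x)-f(S_j(x))\big)$, where $S_j(x)$ is $x$ with the sign of its $j$-th coordinate reversed, and $|\nabla f|(x)=\big(\sum_{j=1}^n|D_jf(x)|^2\big)^{1/2}$. Define $$\delta=\int_{1/2}^{1}\frac{\min\{4p^3(1-p)^3,\,(2p-1)^4p(1-p)\}}{45-3(p(1-p))^3}\,\frac{dp}{\sqrt{p(1-p)}}.$$ This integral converges, $\delta=0.00013\ldots$ (that is, $0.00013\le\delta<0.00014$), and for every $n$ and every $f:\{-1,1\}^n\to\mathbb{R}$, $$\mathbb{E}\,|f(x)-\mathbb{E}f(x)|\le\Big(\frac{\pi}{2}-\delta\Big)\,\mathbb{E}\,|\nabla f|(x).$$ -/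

import Mathlib

open scoped BigOperators

noncomputable section

/-- The hypercube `{-1, 1}ⁿ`; the units of `ℤ` are exactly `1` and `-1`. -/
abbrev Hypercube (n : ℕ) : Type := Fin n → ℤˣ

namespace Hypercube

/-- The expectation `𝔼 g(x)` for `x` uniformly distributed on `{-1, 1}ⁿ`. -/
def mean {n : ℕ} (g : Hypercube n → ℝ) : ℝ :=
  (∑ x : Hypercube n, g x) / 2 ^ n

/-- `S_j(x)`: the point `x` with the sign of its `j`-th coordinate reversed. -/
def flip {n : ℕ} (j : Fin n) (x : Hypercube n) : Hypercube n :=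
  Function.update x j (-x j)

/-- The discrete derivative `D_j f(x) = (f(x) - f(S_j(x))) / 2`. -/
def discreteDeriv {n : ℕ} (j : Fin n) (f : Hypercube n → ℝ) (x : Hypercube n) : ℝ :=
  (f x - f (flip j x)) / 2

/-- The length of the discrete gradient, `|∇f|(x) = (∑_j |D_j f(x)|²)^{1/2}`. -/
def gradNorm {n : ℕ} (f : Hypercube n → ℝ) (x : Hypercube n) : ℝ :=
  Real.sqrt (∑ j : Fin n, |discreteDeriv j f x| ^ 2)

end Hypercube

/-- The gain `min{4p³(1-p)³, (2p-1)⁴p(1-p)} / (45 - 3(p(1-p))³)`. -/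
def biasedGain (p : ℝ) : ℝ :=
  min (4 * p ^ 3 * (1 - p) ^ 3) ((2 * p - 1) ^ 4 * p * (1 - p)) /
    (45 - 3 * (p * (1 - p)) ^ 3)

/-- The integrand that defines the constant `δ`. -/
def poincareIntegrand (p : ℝ) : ℝ :=
  biasedGain p / Real.sqrt (p * (1 - p))

/-- The constant `δ`, the integral over `[1/2, 1]` of the integrand above. -/
def poincareDelta : ℝ :=
  ∫ p in (1 / 2 : ℝ)..1, poincareIntegrand p

end

/-! With g = sign(f - 𝔼f) one has 𝔼|f - 𝔼f| = 𝔼fg - 𝔼f 𝔼g. Let ξ have independent coordinates of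
bias p and put c(p) = 𝔼 f(x) g(xξ). At p = 1 this is 𝔼fg; at p = 1/2 the point xξ is uniform and
independent of x, so c is 𝔼f 𝔼g. The left side is therefore the integral of c' over [1/2, 1].

Write u = p(1-p). Up to the factor 1/u, c'(p) is the average over x and ξ of g(xξ) times the linear
form with coefficients D_j f(x) in the centred coordinates of ξ. Since |g| ≤ 1, only the L¹ norm of
that form matters. Cauchy-Schwarz bounds it by √u |∇f|(x), and ∫ dp/√u = π/2 gives the constant π/2.

The gain δ comes from strictness in Cauchy-Schwarz: equality would force the form to have constant
modulus, but its normalized fourth moment is bounded away from 1 when 1/2 < p < 1. The quantitative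
version (`sq_le_mul_one_sub_biasedMean_abs`) also needs a sixth moment bound
(`biasedMean_linearForm_sixth_le`); together they give `biasedMean_abs_linearForm_le`. -/

namespace Hypercube

/-! ### Moments of linear forms in biased signs -/

/-- The probability that a `±1`-valued variable with `ℙ(1) = p` takes the value `s`. -/
noncomputable def biasedWeight (p : ℝ) (s : ℤˣ) : ℝ := (1 + (2 * p - 1) * ((s : ℤ) : ℝ)) / 2

/-- Half of the centred variable: `1 - p` at `1` and `-p` at `-1`. -/
noncomputable def centred (p : ℝ) (s : ℤˣ) : ℝ := (((s : ℤ) : ℝ) - (2 * p - 1)) / 2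

/-- The expectation over the hypercube with independent coordinates of bias `p`. -/
noncomputable def biasedMean {n : ℕ} (p : ℝ) (F : Hypercube n → ℝ) : ℝ :=
  ∑ ξ : Hypercube n, (∏ i, biasedWeight p (ξ i)) * F ξ

/-- The linear form with coefficients `a` in the centred coordinates. -/
noncomputable def linearForm {n : ℕ} (p : ℝ) (a : Fin n → ℝ) (ξ : Hypercube n) : ℝ :=
  ∑ j, a j * centred p (ξ j)

theorem sum_units (F : ℤˣ → ℝ) : ∑ s, F s = F 1 + F (-1) := by
  rw [UnitsInt.univ, Finset.sum_pair (by decide)]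

theorem biasedWeight_nonneg {p : ℝ} (h0 : 0 ≤ p) (h1 : p ≤ 1) (s : ℤˣ) :
    0 ≤ biasedWeight p s := by
  rcases Int.units_eq_one_or s with rfl | rfl <;> simp [biasedWeight] <;> linarith

theorem biasedMean_zero (p : ℝ) (F : Hypercube 0 → ℝ) : biasedMean p F = F default := by
  simp only [biasedMean, Finset.univ_unique, Finset.univ_eq_empty, Finset.prod_empty, one_mul,
    Finset.sum_singleton]
  exact congrArg F (Subsingleton.elim _ _)

theorem biasedMean_succ {n : ℕ} (p : ℝ) (F : Hypercube (n + 1) → ℝ) :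
    biasedMean p F = p * biasedMean p (fun ξ => F (Fin.cons 1 ξ)) +
      (1 - p) * biasedMean p (fun ξ => F (Fin.cons (-1) ξ)) := by
  unfold biasedMean
  rw [← (Fin.consEquiv (fun _ : Fin (n + 1) => ℤˣ)).sum_comp, Fintype.sum_prod_type, sum_units]
  simp only [Finset.mul_sum]
  congr 1 <;> refine Finset.sum_congr rfl fun ξ _ => ?_ <;>
    simp [Fin.consEquiv, Fin.prod_univ_succ, biasedWeight] <;> ring

theorem biasedMean_add {n : ℕ} (p : ℝ) (F G : Hypercube n → ℝ) :
    biasedMean p (fun ξ => F ξ + G ξ) = biasedMean p F + biasedMean p G := by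
  simp [biasedMean, mul_add, Finset.sum_add_distrib]

theorem biasedMean_const_mul {n : ℕ} (p c : ℝ) (F : Hypercube n → ℝ) :
    biasedMean p (fun ξ => c * F ξ) = c * biasedMean p F := by
  simp only [biasedMean, Finset.mul_sum]
  exact Finset.sum_congr rfl fun ξ _ => by ring

theorem biasedMean_one {n : ℕ} (p : ℝ) : biasedMean p (fun _ : Hypercube n => 1) = 1 := by
  induction n with
  | zero => simp [biasedMean_zero]
  | succ n ih => rw [biasedMean_succ, ih]; ring

theorem biasedMean_const {n : ℕ} (p c : ℝ) : biasedMean p (fun _ : Hypercube n => c) = c := by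
  simpa [biasedMean_one] using biasedMean_const_mul (n := n) p c (fun _ => 1)

theorem biasedMean_mono {n : ℕ} {p : ℝ} (h0 : 0 ≤ p) (h1 : p ≤ 1) {F G : Hypercube n → ℝ}
    (h : ∀ ξ, F ξ ≤ G ξ) : biasedMean p F ≤ biasedMean p G :=
  Finset.sum_le_sum fun ξ _ => mul_le_mul_of_nonneg_left (h ξ)
    (Finset.prod_nonneg fun _ _ => biasedWeight_nonneg h0 h1 _)

theorem linearForm_cons {n : ℕ} (p : ℝ) (a : Fin (n + 1) → ℝ) (s : ℤˣ) (ξ : Hypercube n) :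
    linearForm p a (Fin.cons s ξ) = a 0 * centred p s + linearForm p (fun j => a j.succ) ξ := by
  simp [linearForm, Fin.sum_univ_succ]

theorem biasedMean_linearForm {n : ℕ} (p : ℝ) (a : Fin n → ℝ) :
    biasedMean p (linearForm p a) = 0 := by
  induction n with
  | zero => simp [biasedMean_zero, linearForm]
  | succ n ih =>
    simp only [biasedMean_succ, linearForm_cons, biasedMean_add, biasedMean_const, ih]
    simp [centred]; ring

theorem biasedMean_linearForm_sq {n : ℕ} (p : ℝ) (a : Fin n → ℝ) :
    biasedMean p (fun ξ => linearForm p a ξ ^ 2) = p * (1 - p) * ∑ j, a j ^ 2 := by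
  induction n with
  | zero => simp [biasedMean_zero, linearForm]
  | succ n ih =>
    have expand (b : ℝ) : biasedMean p (fun ξ => (b + linearForm p (fun j => a j.succ) ξ) ^ 2) =
        b ^ 2 + p * (1 - p) * ∑ j : Fin n, a j.succ ^ 2 := by
      rw [show (fun ξ => (b + linearForm p (fun j => a j.succ) ξ) ^ 2) = fun ξ =>
        b ^ 2 + (2 * b * linearForm p (fun j => a j.succ) ξ +
          linearForm p (fun j => a j.succ) ξ ^ 2) from funext fun ξ => by ring]
      rw [biasedMean_add, biasedMean_add, biasedMean_const, biasedMean_const_mul,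
        biasedMean_linearForm, ih]
      ring
    simp only [biasedMean_succ, linearForm_cons, expand, Fin.sum_univ_succ]
    simp [centred]; ring

theorem biasedMean_linearForm_cube {n : ℕ} (p : ℝ) (a : Fin n → ℝ) :
    biasedMean p (fun ξ => linearForm p a ξ ^ 3) =
      p * (1 - p) * (1 - 2 * p) * ∑ j, a j ^ 3 := by
  induction n with
  | zero => simp [biasedMean_zero, linearForm]
  | succ n ih =>
    have expand (b : ℝ) : biasedMean p (fun ξ => (b + linearForm p (fun j => a j.succ) ξ) ^ 3) =
        b ^ 3 + 3 * b * (p * (1 - p) * ∑ j : Fin n, a j.succ ^ 2) +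
          p * (1 - p) * (1 - 2 * p) * ∑ j : Fin n, a j.succ ^ 3 := by
      rw [show (fun ξ => (b + linearForm p (fun j => a j.succ) ξ) ^ 3) = fun ξ =>
        b ^ 3 + (3 * b ^ 2 * linearForm p (fun j => a j.succ) ξ +
          (3 * b * linearForm p (fun j => a j.succ) ξ ^ 2 +
            linearForm p (fun j => a j.succ) ξ ^ 3)) from funext fun ξ => by ring]
      rw [biasedMean_add, biasedMean_add, biasedMean_add, biasedMean_const,
        biasedMean_const_mul, biasedMean_const_mul, biasedMean_linearForm,
        biasedMean_linearForm_sq, ih]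
      ring
    simp only [biasedMean_succ, linearForm_cons, expand, Fin.sum_univ_succ]
    simp [centred]; ring

theorem biasedMean_linearForm_fourth {n : ℕ} (p : ℝ) (a : Fin n → ℝ) :
    biasedMean p (fun ξ => linearForm p a ξ ^ 4) =
      3 * (p * (1 - p)) ^ 2 * (∑ j, a j ^ 2) ^ 2 +
        p * (1 - p) * (1 - 6 * (p * (1 - p))) * ∑ j, a j ^ 4 := by
  induction n with
  | zero => simp [biasedMean_zero, linearForm]
  | succ n ih =>
    have expand (b : ℝ) : biasedMean p (fun ξ => (b + linearForm p (fun j => a j.succ) ξ) ^ 4) =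
        b ^ 4 + 6 * b ^ 2 * (p * (1 - p) * ∑ j : Fin n, a j.succ ^ 2) +
          4 * b * (p * (1 - p) * (1 - 2 * p) * ∑ j : Fin n, a j.succ ^ 3) +
          biasedMean p (fun ξ => linearForm p (fun j => a j.succ) ξ ^ 4) := by
      rw [show (fun ξ => (b + linearForm p (fun j => a j.succ) ξ) ^ 4) = fun ξ =>
        b ^ 4 + (4 * b ^ 3 * linearForm p (fun j => a j.succ) ξ +
          (6 * b ^ 2 * linearForm p (fun j => a j.succ) ξ ^ 2 +
            (4 * b * linearForm p (fun j => a j.succ) ξ ^ 3 +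
              linearForm p (fun j => a j.succ) ξ ^ 4))) from funext fun ξ => by ring]
      rw [biasedMean_add, biasedMean_add, biasedMean_add, biasedMean_add, biasedMean_const,
        biasedMean_const_mul, biasedMean_const_mul, biasedMean_const_mul, biasedMean_linearForm,
        biasedMean_linearForm_sq, biasedMean_linearForm_cube]
      ring
    simp only [biasedMean_succ, linearForm_cons, expand, Fin.sum_univ_succ, ih]
    simp [centred]; ring

theorem sum_fourth_le_sq_sum_sq {n : ℕ} (a : Fin n → ℝ) :
    ∑ j, a j ^ 4 ≤ (∑ j, a j ^ 2) ^ 2 := by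
  have := Finset.sum_sq_le_sq_sum_of_nonneg (s := Finset.univ) (f := fun j => a j ^ 2)
    (fun j _ => sq_nonneg _)
  simpa [← pow_mul] using this

/-- AM-GM in each term, with b³a³ = (b²a)(ba²). -/
theorem cube_mul_sum_cube_le {n : ℕ} (b : ℝ) (a : Fin n → ℝ) :
    b ^ 3 * ∑ j, a j ^ 3 ≤ (b ^ 4 * ∑ j, a j ^ 2 + b ^ 2 * ∑ j, a j ^ 4) / 2 := by
  simp only [Finset.mul_sum, ← Finset.sum_add_distrib, Finset.sum_div]
  exact Finset.sum_le_sum fun j _ => by nlinarith [sq_nonneg (b * a j * (b - a j))]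

/-- Split off one coordinate and compare with the binomial expansion of u(b² + A)³, where A is the
sum of the remaining squares. The cross terms are controlled by u ≤ 1/4. -/
theorem biasedMean_linearForm_sixth_le {n : ℕ} {p : ℝ} (h0 : 0 ≤ p) (h1 : p ≤ 1)
    (a : Fin n → ℝ) :
    biasedMean p (fun ξ => linearForm p a ξ ^ 6) ≤ p * (1 - p) * (∑ j, a j ^ 2) ^ 3 := by
  induction n with
  | zero => simp [biasedMean_zero, linearForm]
  | succ n ih =>
    have expand (b : ℝ) : biasedMean p (fun ξ => (b + linearForm p (fun j => a j.succ) ξ) ^ 6) =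
        b ^ 6 + 15 * b ^ 4 * biasedMean p (fun ξ => linearForm p (fun j => a j.succ) ξ ^ 2) +
          20 * b ^ 3 * biasedMean p (fun ξ => linearForm p (fun j => a j.succ) ξ ^ 3) +
          15 * b ^ 2 * biasedMean p (fun ξ => linearForm p (fun j => a j.succ) ξ ^ 4) +
          6 * b * biasedMean p (fun ξ => linearForm p (fun j => a j.succ) ξ ^ 5) +
          biasedMean p (fun ξ => linearForm p (fun j => a j.succ) ξ ^ 6) := by
      rw [show (fun ξ => (b + linearForm p (fun j => a j.succ) ξ) ^ 6) = fun ξ =>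
        b ^ 6 + (6 * b ^ 5 * linearForm p (fun j => a j.succ) ξ +
          (15 * b ^ 4 * linearForm p (fun j => a j.succ) ξ ^ 2 +
            (20 * b ^ 3 * linearForm p (fun j => a j.succ) ξ ^ 3 +
              (15 * b ^ 2 * linearForm p (fun j => a j.succ) ξ ^ 4 +
                (6 * b * linearForm p (fun j => a j.succ) ξ ^ 5 +
                  linearForm p (fun j => a j.succ) ξ ^ 6))))) from funext fun ξ => by ring]
      rw [biasedMean_add, biasedMean_add, biasedMean_add, biasedMean_add, biasedMean_add,
        biasedMean_add, biasedMean_const, biasedMean_const_mul, biasedMean_const_mul,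
        biasedMean_const_mul, biasedMean_const_mul, biasedMean_const_mul, biasedMean_linearForm]
      ring
    simp only [biasedMean_succ, linearForm_cons, expand, Fin.sum_univ_succ]
    have h6 := ih (fun j => a j.succ)
    have h3 := cube_mul_sum_cube_le (a 0) (fun j => a j.succ)
    have hS := sum_fourth_le_sq_sum_sq (fun j => a j.succ)
    have hS0 : 0 ≤ ∑ j : Fin n, a j.succ ^ 4 := Finset.sum_nonneg fun j _ => by positivity
    have hA0 : 0 ≤ ∑ j : Fin n, a j.succ ^ 2 := Finset.sum_nonneg fun j _ => by positivity
    rw [biasedMean_linearForm_sq, biasedMean_linearForm_cube, biasedMean_linearForm_fourth]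
    generalize biasedMean p (fun ξ => linearForm p (fun j => a j.succ) ξ ^ 6) = M at *
    -- The fifth moment enters multiplied by the mean of a centred variable, which is 0, so it needs
    -- no bound.
    generalize biasedMean p (fun ξ => linearForm p (fun j => a j.succ) ξ ^ 5) = M5 at *
    generalize ∑ j : Fin n, a j.succ ^ 2 = A at *
    generalize ∑ j : Fin n, a j.succ ^ 3 = T at *
    generalize ∑ j : Fin n, a j.succ ^ 4 = S at *
    generalize a 0 = b at *
    have hu0 : 0 ≤ p * (1 - p) := mul_nonneg h0 (by linarith)
    have hu1 : 4 * (p * (1 - p)) ≤ 1 := by nlinarith [sq_nonneg (2 * p - 1)]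
    have hd : (1 - 2 * p) ^ 2 = 1 - 4 * (p * (1 - p)) := by ring
    have key : M + 15 * b ^ 2 * (p * (1 - p)) * (3 * (p * (1 - p)) ^ 2 * A ^ 2 +
        p * (1 - p) * (1 - 6 * (p * (1 - p))) * S) +
        20 * (p * (1 - p)) ^ 2 * (1 - 2 * p) ^ 2 * (b ^ 3 * T) +
        15 * b ^ 4 * (p * (1 - p)) ^ 2 * (1 - 3 * (p * (1 - p))) * A +
        b ^ 6 * (p * (1 - p)) * (1 - 5 * (p * (1 - p)) + 5 * (p * (1 - p)) ^ 2) ≤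
        p * (1 - p) * (b ^ 2 + A) ^ 3 := by
      rw [hd]
      generalize p * (1 - p) = u at *
      have e4 : 3 * u ^ 2 * A ^ 2 + u * (1 - 6 * u) * S ≤ u * (1 - u) * A ^ 2 := by
        rcases le_total (6 * u) 1 with h | h
        · nlinarith [mul_nonneg (mul_nonneg hu0 (sub_nonneg.2 h)) (sub_nonneg.2 hS),
            mul_nonneg (sq_nonneg u) (sq_nonneg A)]
        · nlinarith [mul_nonneg (mul_nonneg hu0 (sub_nonneg.2 h)) hS0,
            mul_nonneg (mul_nonneg hu0 (sub_nonneg.2 hu1)) (sq_nonneg A)]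
      have e3 : b ^ 3 * T ≤ (b ^ 4 * A + b ^ 2 * A ^ 2) / 2 := by
        nlinarith [mul_le_mul_of_nonneg_left hS (sq_nonneg b)]
      have f4 := mul_le_mul_of_nonneg_left e4 (show 0 ≤ 15 * b ^ 2 * u by positivity)
      have f3 := mul_le_mul_of_nonneg_left e3
        (show 0 ≤ 20 * u ^ 2 * (1 - 4 * u) from mul_nonneg (by positivity) (by linarith))
      -- `c1`, `c2` and `c3` are the surpluses in the coefficients of b²A², b⁴A and b⁶ (the last up
      -- to a factor 5) once `e3` and `e4` are inserted.
      have c1 : 0 ≤ 3 * u - 25 * u ^ 2 + 55 * u ^ 3 := by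
        nlinarith [mul_nonneg hu0 (sq_nonneg (u - 5 / 22))]
      have c2 : 0 ≤ 3 * u - 25 * u ^ 2 + 85 * u ^ 3 := by
        nlinarith [pow_nonneg hu0 3]
      have c3 : 0 ≤ u ^ 2 * (1 - u) := mul_nonneg (sq_nonneg u) (by linarith)
      nlinarith [mul_nonneg c1 (mul_nonneg (sq_nonneg b) (sq_nonneg A)),
        mul_nonneg c2 (mul_nonneg (sq_nonneg (b ^ 2)) hA0),
        mul_nonneg c3 (sq_nonneg (b ^ 3))]
    refine le_trans (le_of_eq ?_) key
    simp [centred]; ring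

end Hypercube

/-! ### The gain over Cauchy-Schwarz -/

namespace Hypercube

/-- If `𝔼 y² = 1`, `𝔼 y⁴ = 1 + V` and `𝔼 y⁶ ≤ C`, then `𝔼 |y| ≤ 1 - V² / (4C)`. -/
theorem sq_le_mul_one_sub_biasedMean_abs {n : ℕ} {p : ℝ} (h0 : 0 ≤ p) (h1 : p ≤ 1)
    (y : Hypercube n → ℝ) {V C : ℝ} (hV : 0 < V) (hC : 0 < C)
    (h2 : biasedMean p (fun ξ => y ξ ^ 2) = 1) (h4 : biasedMean p (fun ξ => y ξ ^ 4) = 1 + V)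
    (h6 : biasedMean p (fun ξ => y ξ ^ 6) ≤ C) :
    V ^ 2 ≤ 4 * C * (1 - biasedMean p (fun ξ => |y ξ|)) := by
  have pointwise (L t : ℝ) (hL : 0 ≤ L) (ht : 0 ≤ t) :
      L * (t ^ 2 - 1) ^ 2 - (t ^ 2 - 1) ^ 2 * (1 + t ^ 2) ≤ L ^ 2 / 2 * (t - 1) ^ 2 := by
    -- With w = 1 + t² ≤ L, use (t + 1)² ≤ 2w and then 2w(L - w) ≤ L²/2; for w ≥ L the left side is
    -- not positive.
    have : (t + 1) ^ 2 * (L - (1 + t ^ 2)) ≤ L ^ 2 / 2 := by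
      rcases le_total (1 + t ^ 2) L with h | h
      · nlinarith [mul_nonneg (sq_nonneg (t - 1)) (sub_nonneg.2 h),
          sq_nonneg (L - 2 * (1 + t ^ 2))]
      · nlinarith [mul_nonneg (sq_nonneg (t + 1)) (sub_nonneg.2 h), sq_nonneg L]
    nlinarith [mul_le_mul_of_nonneg_left this (sq_nonneg (t - 1))]
  -- Averaging the pointwise bound gives LV - C ≤ L²(1 - 𝔼|y|). The choice L = 2C/V maximizes (LV -
  -- C)/L², with value V²/(4C).
  have hL : 0 < 2 * C / V := by positivity
  have main := biasedMean_mono h0 h1 (F := fun ξ => (2 * C / V - 1) * 1 +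
      ((1 - 2 * (2 * C / V)) * y ξ ^ 2 + ((1 + 2 * C / V) * y ξ ^ 4 + (-1) * y ξ ^ 6)))
    (G := fun ξ => ((2 * C / V) ^ 2 / 2) * 1 + ((2 * C / V) ^ 2 / 2 * y ξ ^ 2 +
      (-(2 * C / V) ^ 2) * |y ξ|)) fun ξ => by
      have := pointwise (2 * C / V) |y ξ| hL.le (abs_nonneg _)
      rw [sq_abs] at this
      nlinarith [sq_abs (y ξ)]
  simp only [biasedMean_add, biasedMean_const_mul, biasedMean_one, h2, h4] at main
  generalize biasedMean p (fun ξ => |y ξ|) = m at *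
  have h : 2 * C / V * V - C ≤ (2 * C / V) ^ 2 * (1 - m) := by nlinarith
  have e1 : 2 * C / V * V = 2 * C := by field_simp
  have e2 : (2 * C / V) ^ 2 * V ^ 2 = 4 * C ^ 2 := by field_simp; ring
  rw [e1] at h
  have h' := mul_le_mul_of_nonneg_right h (sq_nonneg V)
  have e3 : (2 * C / V) ^ 2 * (1 - m) * V ^ 2 = 4 * C ^ 2 * (1 - m) := by rw [← e2]; ring
  rw [e3] at h'
  exact le_of_mul_le_mul_left (by nlinarith) hC

/-- The right side is what the moment argument yields. The gain in the theorem is weaker: its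
numerator carries an extra factor 4u ≤ 1, and its denominator exceeds 1. -/
theorem biasedGain_le {p : ℝ} (h0 : 0 < p) (h1 : p < 1) :
    biasedGain p ≤ min ((p * (1 - p)) ^ 2) ((2 * p - 1) ^ 4 / 4) := by
  have hu0 : 0 < p * (1 - p) := mul_pos h0 (by linarith)
  have hu1 : 4 * (p * (1 - p)) ≤ 1 := by nlinarith [sq_nonneg (2 * p - 1)]
  have hu3 : (p * (1 - p)) ^ 3 ≤ 1 := pow_le_one₀ hu0.le (by linarith)
  have hd : 0 < 45 - 3 * (p * (1 - p)) ^ 3 := by linarith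
  have e1 : 4 * p ^ 3 * (1 - p) ^ 3 = 4 * (p * (1 - p)) * (p * (1 - p)) ^ 2 := by ring
  have e2 : (2 * p - 1) ^ 4 * p * (1 - p) = (2 * p - 1) ^ 4 * (p * (1 - p)) := by ring
  rw [biasedGain, e1, e2, div_le_iff₀ hd]
  generalize p * (1 - p) = u at *
  have hs : 0 ≤ (2 * p - 1) ^ 4 := by positivity
  generalize (2 * p - 1) ^ 4 = s at *
  rcases le_total (u ^ 2) (s / 4) with h | h
  · rw [min_eq_left h]
    refine (min_le_left _ _).trans ?_
    nlinarith [sq_nonneg u]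
  · rw [min_eq_right h]
    refine (min_le_right _ _).trans ?_
    nlinarith

theorem biasedMean_abs_linearForm_le_of_unit {n : ℕ} {p : ℝ} (h0 : 1 / 2 < p) (h1 : p < 1)
    (a : Fin n → ℝ) (ha : ∑ j, a j ^ 2 = 1) :
    biasedMean p (fun ξ => |linearForm p a ξ|) ≤
      (1 - biasedGain p) * Real.sqrt (p * (1 - p)) := by
  have hu0 : 0 < p * (1 - p) := mul_pos (by linarith) (by linarith)
  have hr : 0 < Real.sqrt (p * (1 - p)) := Real.sqrt_pos.2 hu0
  have hr2 := Real.sq_sqrt hu0.le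
  have hg := biasedGain_le (by linarith) h1
  have hs : (2 * p - 1) ^ 2 = 1 - 4 * (p * (1 - p)) := by ring
  have hs4 : (2 * p - 1) ^ 4 = (1 - 4 * (p * (1 - p))) ^ 2 := by rw [← hs]; ring
  have hs0 : 0 < 1 - 4 * (p * (1 - p)) := hs ▸ pow_pos (by linarith) 2
  have m2 := biasedMean_linearForm_sq p a
  have m4 := biasedMean_linearForm_fourth p a
  have m6 := biasedMean_linearForm_sixth_le (by linarith) h1.le a
  have hS := sum_fourth_le_sq_sum_sq a
  have hS0 : 0 ≤ ∑ j, a j ^ 4 := Finset.sum_nonneg fun j _ => by positivity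
  rw [ha] at m2 m4 m6 hS
  rw [hs4] at hg
  set r := Real.sqrt (p * (1 - p)) with hrdef
  set u := p * (1 - p) with hu
  set S := ∑ j, a j ^ 4
  have hr4 : r ^ 4 = u ^ 2 := by rw [← hr2]; ring
  have hr6 : r ^ 6 = u ^ 3 := by rw [← hr2]; ring
  set V := 2 + (1 - 6 * u) * S / u with hVdef
  have hVu : V * u = 2 * u + (1 - 6 * u) * S := by rw [hVdef]; field_simp
  -- Vu is affine in S ∈ [0, 1], with value 2u at S = 0 and 1 - 4u = (2p-1)² at S = 1.
  have hV : min (2 * u) (1 - 4 * u) ≤ V * u := by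
    rw [hVu]
    rcases le_total (6 * u) 1 with h | h
    · exact (min_le_left _ _).trans (by nlinarith)
    · exact (min_le_right _ _).trans (by nlinarith)
  have hmin : 0 < min (2 * u) (1 - 4 * u) := lt_min (by linarith) hs0
  have hV0 : 0 < V := pos_of_mul_pos_left (hmin.trans_le hV) hu0.le
  have div_mean (k : ℕ) : biasedMean p (fun ξ => (linearForm p a ξ / r) ^ k) =
      (r ^ k)⁻¹ * biasedMean p (fun ξ => linearForm p a ξ ^ k) := by
    rw [← biasedMean_const_mul]
    congr 1; ext ξ; rw [div_pow]; ring
  have habs : biasedMean p (fun ξ => |linearForm p a ξ / r|) =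
      r⁻¹ * biasedMean p (fun ξ => |linearForm p a ξ|) := by
    rw [← biasedMean_const_mul]
    congr 1; ext ξ; rw [abs_div, abs_of_pos hr]; ring
  have main := sq_le_mul_one_sub_biasedMean_abs (p := p) (by linarith) h1.le
    (fun ξ => linearForm p a ξ / r) (V := V) (C := 1 / u ^ 2) hV0 (by positivity)
    (by rw [div_mean, m2, hr2]; field_simp)
    (by rw [div_mean, m4, hr4, hVdef]; field_simp; ring)
    (by
      rw [div_mean, hr6]
      calc (u ^ 3)⁻¹ * _ ≤ (u ^ 3)⁻¹ * (u * 1 ^ 3) :=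
            mul_le_mul_of_nonneg_left m6 (by positivity)
        _ = 1 / u ^ 2 := by field_simp)
  rw [habs] at main
  have h4 : (V * u) ^ 2 / 4 ≤ 1 - r⁻¹ * biasedMean p (fun ξ => |linearForm p a ξ|) := by
    have := mul_le_mul_of_nonneg_right main (sq_nonneg u)
    have e : 4 * (1 / u ^ 2) * (1 - r⁻¹ * biasedMean p (fun ξ => |linearForm p a ξ|)) * u ^ 2 =
      4 * (1 - r⁻¹ * biasedMean p (fun ξ => |linearForm p a ξ|)) := by field_simp
    rw [e] at this
    nlinarith
  have hgain : biasedGain p ≤ (V * u) ^ 2 / 4 := by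
    refine hg.trans ?_
    have := pow_le_pow_left₀ hmin.le hV 2
    clear_value V u
    rcases le_total (2 * u) (1 - 4 * u) with h | h
    · rw [min_eq_left h] at this
      exact (min_le_left _ _).trans (by linarith)
    · rw [min_eq_right h] at this
      exact (min_le_right _ _).trans (by linarith)
  have h5 : r⁻¹ * biasedMean p (fun ξ => |linearForm p a ξ|) ≤ 1 - biasedGain p := by linarith
  rwa [inv_mul_le_iff₀ hr, mul_comm] at h5

/-- The `L¹` norm of a linear form falls short of its `L²` norm by the factor
`1 - biasedGain p`. -/
theorem biasedMean_abs_linearForm_le {n : ℕ} {p : ℝ} (h0 : 1 / 2 < p) (h1 : p < 1)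
    (a : Fin n → ℝ) :
    biasedMean p (fun ξ => |linearForm p a ξ|) ≤
      (1 - biasedGain p) * Real.sqrt (p * (1 - p)) * Real.sqrt (∑ j, a j ^ 2) := by
  rcases (Finset.sum_nonneg fun j _ => sq_nonneg (a j) :
    0 ≤ ∑ j, a j ^ 2).eq_or_lt with h | h
  · have ha : ∀ j, a j = 0 := fun j => by
      have := (Finset.sum_eq_zero_iff_of_nonneg fun j _ => sq_nonneg (a j)).1 h.symm j
        (Finset.mem_univ j)
      exact pow_eq_zero_iff two_ne_zero |>.1 this
    simp [linearForm, ha, biasedMean_const]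
  · have hA := Real.sqrt_pos.2 h
    have := biasedMean_abs_linearForm_le_of_unit h0 h1
      (fun j => a j / Real.sqrt (∑ j, a j ^ 2)) (by
        simp only [div_pow, ← Finset.sum_div]
        rw [Real.sq_sqrt h.le, div_self h.ne'])
    have e : (fun ξ => |linearForm p a ξ|) = fun ξ => Real.sqrt (∑ j, a j ^ 2) *
        |linearForm p (fun j => a j / Real.sqrt (∑ j, a j ^ 2)) ξ| := by
      ext ξ
      rw [← abs_of_pos hA, ← abs_mul, abs_of_pos hA, linearForm, linearForm, Finset.mul_sum]
      congr 2; ext j; field_simp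
    rw [e, biasedMean_const_mul, mul_comm]
    exact mul_le_mul_of_nonneg_right this hA.le

end Hypercube

/-! ### Integrals against dp/√(p(1-p)) -/

theorem sqrt_mul_one_sub_pos {p : ℝ} (hp : p ∈ Set.Ioo (1 / 2 : ℝ) 1) :
    0 < Real.sqrt (p * (1 - p)) :=
  Real.sqrt_pos.2 (mul_pos (by linarith [hp.1]) (by linarith [hp.2]))

theorem hasDerivAt_arcsin_two_mul_sub_one {p : ℝ} (hp : p ∈ Set.Ioo (1 / 2 : ℝ) 1) :
    HasDerivAt (fun p => Real.arcsin (2 * p - 1)) (1 / Real.sqrt (p * (1 - p))) p := by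
  have h := (Real.hasDerivAt_arcsin (x := 2 * p - 1) (by linarith [hp.1]) (by linarith [hp.2])).comp
    p (((hasDerivAt_id p).const_mul 2).sub_const 1)
  refine h.congr_deriv ?_
  have hr := sqrt_mul_one_sub_pos hp
  have : Real.sqrt (1 - (2 * p - 1) ^ 2) = 2 * Real.sqrt (p * (1 - p)) := by
    rw [show 1 - (2 * p - 1) ^ 2 = 2 ^ 2 * (p * (1 - p)) by ring,
      Real.sqrt_mul (by positivity), Real.sqrt_sq (by norm_num)]
  rw [this]
  field_simp

theorem hasDerivAt_sqrt_mul_one_sub {p : ℝ} (hp : p ∈ Set.Ioo (1 / 2 : ℝ) 1) :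
    HasDerivAt (fun p => Real.sqrt (p * (1 - p)))
      ((1 - 2 * p) / (2 * Real.sqrt (p * (1 - p)))) p := by
  have h : HasDerivAt (fun p : ℝ => p * (1 - p)) (1 - 2 * p) p :=
    ((hasDerivAt_id p).mul ((hasDerivAt_id p).const_sub 1)).congr_deriv (by simp; ring)
  exact h.sqrt (mul_pos (by linarith [hp.1]) (by linarith [hp.2])).ne'

theorem intervalIntegrable_one_div_sqrt :
    IntervalIntegrable (fun p : ℝ => 1 / Real.sqrt (p * (1 - p))) MeasureTheory.volume
      (1 / 2) 1 := by
  -- Despite the singularity at p = 1, the integrand is a nonnegative derivative of a function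
  -- continuous up to the endpoint.
  refine intervalIntegral.intervalIntegrable_deriv_of_nonneg
    (g := fun p => Real.arcsin (2 * p - 1))
    (Real.continuous_arcsin.comp (by fun_prop)).continuousOn ?_ ?_
  · intro p hp
    rw [min_eq_left (by norm_num), max_eq_right (by norm_num)] at hp
    exact hasDerivAt_arcsin_two_mul_sub_one hp
  · intro p _
    positivity

theorem integral_one_div_sqrt :
    ∫ p in (1 / 2 : ℝ)..1, 1 / Real.sqrt (p * (1 - p)) = Real.pi / 2 := by
  rw [intervalIntegral.integral_eq_sub_of_hasDerivAt_of_le (by norm_num)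
    (f := fun p => Real.arcsin (2 * p - 1))
    (Real.continuous_arcsin.comp (by fun_prop)).continuousOn
    (fun p hp => hasDerivAt_arcsin_two_mul_sub_one hp) intervalIntegrable_one_div_sqrt]
  norm_num

theorem intervalIntegrable_div_sqrt {h : ℝ → ℝ} (hh : ContinuousOn h (Set.Icc (1 / 2) 1)) :
    IntervalIntegrable (fun p => h p / Real.sqrt (p * (1 - p))) MeasureTheory.volume
      (1 / 2) 1 := by
  have := intervalIntegrable_one_div_sqrt.continuousOn_mul (g := h)
    (by rwa [Set.uIcc_of_le (by norm_num)])
  simpa only [mul_one_div] using this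

theorem mul_one_sub_cube_mem {p : ℝ} (hp : p ∈ Set.Icc (1 / 2 : ℝ) 1) :
    0 ≤ (p * (1 - p)) ^ 3 ∧ (p * (1 - p)) ^ 3 ≤ 1 / 64 := by
  have hu0 : 0 ≤ p * (1 - p) := mul_nonneg (by linarith [hp.1]) (by linarith [hp.2])
  have hu1 : p * (1 - p) ≤ 1 / 4 := by nlinarith [sq_nonneg (2 * p - 1)]
  exact ⟨by positivity, (pow_le_pow_left₀ hu0 hu1 3).trans (by norm_num)⟩

theorem continuousOn_biasedGain : ContinuousOn biasedGain (Set.Icc (1 / 2) 1) := by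
  unfold biasedGain
  refine ContinuousOn.div (by fun_prop) (by fun_prop) fun p hp => ?_
  have := mul_one_sub_cube_mem hp
  intro h
  linarith

theorem intervalIntegrable_poincareIntegrand :
    IntervalIntegrable poincareIntegrand MeasureTheory.volume (1 / 2) 1 :=
  intervalIntegrable_div_sqrt continuousOn_biasedGain

/-! ### Numerical value of δ -/

/-- The numerator of `biasedGain`. -/
noncomputable def gainNumerator (p : ℝ) : ℝ :=
  min (4 * p ^ 3 * (1 - p) ^ 3) ((2 * p - 1) ^ 4 * p * (1 - p))

theorem gainNumerator_nonneg {p : ℝ} (hp : p ∈ Set.Icc (1 / 2 : ℝ) 1) : 0 ≤ gainNumerator p := by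
  have h0 : 0 ≤ p := by linarith [hp.1]
  have h1 : 0 ≤ 1 - p := by linarith [hp.2]
  exact le_min (by positivity) (by positivity)

/-- The point of `[1/2, 1]` where `p(1-p) = 1/6` and the two terms of the minimum agree. -/
noncomputable def crossing : ℝ := (1 + 1 / Real.sqrt 3) / 2

theorem two_mul_crossing_sub_one : 2 * crossing - 1 = 1 / Real.sqrt 3 := by
  rw [crossing]; ring

theorem crossing_mem : crossing ∈ Set.Ioo (1 / 2 : ℝ) 1 := by
  have h : 1 < Real.sqrt 3 := Real.lt_sqrt_of_sq_lt (by norm_num)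
  have h' : 1 / Real.sqrt 3 < 1 := (div_lt_one (by linarith)).2 h
  have h'' : 0 < 1 / Real.sqrt 3 := by positivity
  constructor <;> rw [crossing] <;> linarith

theorem crossing_mul_one_sub : crossing * (1 - crossing) = 1 / 6 := by
  have h : (1 / Real.sqrt 3) ^ 2 = 1 / 3 := by
    rw [div_pow, Real.sq_sqrt (by norm_num)]; norm_num
  rw [crossing]
  linear_combination (-1 / 4) * h

theorem gainNumerator_eq_left {p : ℝ} (hp : p ∈ Set.Icc (1 / 2) crossing) :
    gainNumerator p = (2 * p - 1) ^ 4 * (p * (1 - p)) := by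
  have hu : 1 / 6 ≤ p * (1 - p) := by
    rw [← crossing_mul_one_sub]
    nlinarith [mul_nonneg (sub_nonneg.2 hp.2) (show 0 ≤ p + crossing - 1 by
      linarith [hp.1, crossing_mem.1])]
  have hu1 : 4 * (p * (1 - p)) ≤ 1 := by nlinarith [sq_nonneg (2 * p - 1)]
  have e : (2 * p - 1) ^ 4 = (1 - 4 * (p * (1 - p))) ^ 2 := by ring
  have e' : 4 * p ^ 3 * (1 - p) ^ 3 = 4 * (p * (1 - p)) ^ 2 * (p * (1 - p)) := by ring
  rw [gainNumerator, mul_assoc ((2 * p - 1) ^ 4), e, e']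
  generalize p * (1 - p) = u at *
  refine min_eq_right (mul_le_mul_of_nonneg_right ?_ (by linarith))
  nlinarith

theorem gainNumerator_eq_right {p : ℝ} (hp : p ∈ Set.Icc crossing 1) :
    gainNumerator p = 4 * (p * (1 - p)) ^ 3 := by
  have hu : p * (1 - p) ≤ 1 / 6 := by
    rw [← crossing_mul_one_sub]
    nlinarith [mul_nonneg (sub_nonneg.2 hp.1) (show 0 ≤ p + crossing - 1 by
      linarith [hp.1, crossing_mem.1])]
  have hu0 : 0 ≤ p * (1 - p) :=
    mul_nonneg (by linarith [hp.1, crossing_mem.1]) (by linarith [hp.2])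
  have e : (2 * p - 1) ^ 4 = (1 - 4 * (p * (1 - p))) ^ 2 := by ring
  have e' : 4 * p ^ 3 * (1 - p) ^ 3 = 4 * (p * (1 - p)) ^ 2 * (p * (1 - p)) := by ring
  rw [gainNumerator, mul_assoc ((2 * p - 1) ^ 4), e, e',
    show 4 * (p * (1 - p)) ^ 3 = 4 * (p * (1 - p)) ^ 2 * (p * (1 - p)) by ring]
  generalize p * (1 - p) = u at *
  refine min_eq_left (mul_le_mul_of_nonneg_right ?_ hu0)
  nlinarith

/-- A primitive of `(2p-1)⁴ p(1-p) / √(p(1-p))`. -/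
noncomputable def primitiveLeft (p : ℝ) : ℝ :=
  Real.arcsin (2 * p - 1) / 64 + Real.sqrt (p * (1 - p)) * (2 * p - 1) *
    (4 / 3 * (p * (1 - p)) ^ 2 - 7 / 12 * (p * (1 - p)) + 1 / 32)

/-- A primitive of `4 (p(1-p))³ / √(p(1-p))`. -/
noncomputable def primitiveRight (p : ℝ) : ℝ :=
  5 * Real.arcsin (2 * p - 1) / 256 + Real.sqrt (p * (1 - p)) * (2 * p - 1) *
    (1 / 3 * (p * (1 - p)) ^ 2 + 5 / 48 * (p * (1 - p)) + 5 / 128)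

/-- With s = 2p - 1 one has s² = 1 - 4u and u' = -s, so the derivative is a cubic polynomial in u
divided by √u. Matching its four coefficients determines a, b, c, d in both primitives. -/
theorem hasDerivAt_arcsin_add_sqrt {p : ℝ} (hp : p ∈ Set.Ioo (1 / 2 : ℝ) 1) (a b c d : ℝ) :
    HasDerivAt (fun p => a * Real.arcsin (2 * p - 1) + Real.sqrt (p * (1 - p)) *
      ((2 * p - 1) * (b * (p * (1 - p)) ^ 2 + c * (p * (1 - p)) + d)))
      ((a + (-(1 - 4 * (p * (1 - p))) / 2 + 2 * (p * (1 - p))) *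
        (b * (p * (1 - p)) ^ 2 + c * (p * (1 - p)) + d) -
        (1 - 4 * (p * (1 - p))) * (p * (1 - p)) * (2 * b * (p * (1 - p)) + c)) /
        Real.sqrt (p * (1 - p))) p := by
  have hr := sqrt_mul_one_sub_pos hp
  have hu : HasDerivAt (fun p : ℝ => p * (1 - p)) (1 - 2 * p) p :=
    ((hasDerivAt_id p).mul ((hasDerivAt_id p).const_sub 1)).congr_deriv (by simp; ring)
  have hs : HasDerivAt (fun p : ℝ => 2 * p - 1) 2 p :=
    (((hasDerivAt_id p).const_mul 2).sub_const 1).congr_deriv (by simp)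
  have hP := ((((hu.pow 2).const_mul b).add (hu.const_mul c)).add_const d)
  refine (((hasDerivAt_arcsin_two_mul_sub_one hp).const_mul a).add
    ((hasDerivAt_sqrt_mul_one_sub hp).mul (hs.mul hP))).congr_deriv ?_
  have hr2 : Real.sqrt (p * (1 - p)) ^ 2 = p * (1 - p) :=
    Real.sq_sqrt (mul_nonneg (by linarith [hp.1]) (by linarith [hp.2]))
  simp only [Pi.add_apply, Pi.mul_apply, Pi.pow_apply]
  generalize Real.sqrt (p * (1 - p)) = r at *
  field_simp
  rw [hr2]
  ring

theorem hasDerivAt_primitiveLeft {p : ℝ} (hp : p ∈ Set.Ioo (1 / 2 : ℝ) 1) :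
    HasDerivAt primitiveLeft
      ((2 * p - 1) ^ 4 * (p * (1 - p)) / Real.sqrt (p * (1 - p))) p := by
  have h := hasDerivAt_arcsin_add_sqrt hp (1 / 64) (4 / 3) (-7 / 12) (1 / 32)
  refine (h.congr_deriv ?_).congr_of_eventuallyEq (.of_forall fun x => ?_)
  · congr 1; ring
  · rw [primitiveLeft]; ring

theorem hasDerivAt_primitiveRight {p : ℝ} (hp : p ∈ Set.Ioo (1 / 2 : ℝ) 1) :
    HasDerivAt primitiveRight (4 * (p * (1 - p)) ^ 3 / Real.sqrt (p * (1 - p))) p := by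
  have h := hasDerivAt_arcsin_add_sqrt hp (5 / 256) (1 / 3) (5 / 48) (5 / 128)
  refine (h.congr_deriv ?_).congr_of_eventuallyEq (.of_forall fun x => ?_)
  · congr 1; ring
  · rw [primitiveRight]; ring

theorem continuous_primitiveLeft : Continuous primitiveLeft := by
  unfold primitiveLeft
  have := Real.continuous_arcsin
  fun_prop

theorem continuous_primitiveRight : Continuous primitiveRight := by
  unfold primitiveRight
  have := Real.continuous_arcsin
  fun_prop

theorem intervalIntegrable_gainNumerator :
    IntervalIntegrable (fun p => gainNumerator p / Real.sqrt (p * (1 - p)))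
      MeasureTheory.volume (1 / 2) 1 := by
  refine intervalIntegrable_div_sqrt ?_
  unfold gainNumerator
  fun_prop

theorem sqrt_crossing_mul :
    Real.sqrt (crossing * (1 - crossing)) * (2 * crossing - 1) = Real.sqrt 2 / 6 := by
  have h2 : Real.sqrt 2 ^ 2 = 2 := Real.sq_sqrt (by norm_num)
  have h3 : Real.sqrt 3 ^ 2 = 3 := Real.sq_sqrt (by norm_num)
  have h6 : Real.sqrt 6 = Real.sqrt 2 * Real.sqrt 3 := by
    rw [← Real.sqrt_mul (by norm_num)]; norm_num
  rw [crossing_mul_one_sub, two_mul_crossing_sub_one, one_div, Real.sqrt_inv, h6]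
  have : 0 < Real.sqrt 2 := by positivity
  have : 0 < Real.sqrt 3 := by positivity
  field_simp
  rw [h2, h3]; norm_num

theorem integral_gainNumerator :
    ∫ p in (1 / 2 : ℝ)..1, gainNumerator p / Real.sqrt (p * (1 - p)) =
      5 * Real.pi / 512 - Real.arcsin (1 / Real.sqrt 3) / 256 - 109 * Real.sqrt 2 / 6912 := by
  have hc := crossing_mem
  have hsub1 : Set.uIcc (1 / 2) crossing ⊆ Set.uIcc (1 / 2 : ℝ) 1 := by
    rw [Set.uIcc_of_le hc.1.le, Set.uIcc_of_le (by norm_num)]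
    exact Set.Icc_subset_Icc_right hc.2.le
  have hsub2 : Set.uIcc crossing 1 ⊆ Set.uIcc (1 / 2 : ℝ) 1 := by
    rw [Set.uIcc_of_le hc.2.le, Set.uIcc_of_le (by norm_num)]
    exact Set.Icc_subset_Icc_left hc.1.le
  have i1 := intervalIntegrable_gainNumerator.mono_set hsub1
  have i2 := intervalIntegrable_gainNumerator.mono_set hsub2
  rw [← intervalIntegral.integral_add_adjacent_intervals i1 i2,
    intervalIntegral.integral_eq_sub_of_hasDerivAt_of_le hc.1.le
      continuous_primitiveLeft.continuousOn (fun p hp => by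
        rw [gainNumerator_eq_left ⟨hp.1.le, hp.2.le⟩]
        exact hasDerivAt_primitiveLeft ⟨hp.1, hp.2.trans hc.2⟩) i1,
    intervalIntegral.integral_eq_sub_of_hasDerivAt_of_le hc.2.le
      continuous_primitiveRight.continuousOn (fun p hp => by
        rw [gainNumerator_eq_right ⟨hp.1.le, hp.2.le⟩]
        exact hasDerivAt_primitiveRight ⟨hc.1.trans hp.1, hp.2⟩) i2]
  simp only [primitiveLeft, primitiveRight, sqrt_crossing_mul]
  rw [crossing_mul_one_sub, two_mul_crossing_sub_one]
  norm_num
  ring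

theorem arcsin_one_div_sqrt_three_bounds :
    0.577 ≤ Real.arcsin (1 / Real.sqrt 3) ∧ Real.arcsin (1 / Real.sqrt 3) ≤ 0.63 := by
  have h3 : Real.sqrt 3 < 1.733 := (Real.sqrt_lt' (by norm_num)).2 (by norm_num)
  have h3' : 1.732 < Real.sqrt 3 := Real.lt_sqrt_of_sq_lt (by norm_num)
  have h0 : 0 < Real.sqrt 3 := by positivity
  have hpi := Real.pi_gt_three
  constructor
  · refine (Real.le_arcsin_iff_sin_le ⟨by linarith, by linarith⟩
      ⟨by linarith [show 0 < 1 / Real.sqrt 3 by positivity],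
        (div_le_one h0).2 (by linarith)⟩).2 ?_
    refine (Real.sin_lt (by norm_num)).le.trans ?_
    rw [le_div_iff₀ h0]
    linarith
  · refine (Real.arcsin_le_iff_le_sin ⟨by linarith [show 0 < 1 / Real.sqrt 3 by positivity],
        (div_le_one h0).2 (by linarith)⟩ ⟨by linarith, by linarith⟩).2 ?_
    have := (abs_le.1 (Real.sin_bound (x := 0.63) (by rw [abs_of_pos] <;> norm_num))).1
    rw [abs_of_pos (by norm_num)] at this
    refine le_trans ?_ (by linarith : (0.63 : ℝ) - 0.63 ^ 3 / 6 - 0.63 ^ 5 / 100 ≤ Real.sin 0.63)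
    rw [div_le_iff₀ h0]
    linarith

theorem poincareDelta_bounds : 0.00013 ≤ poincareDelta ∧ poincareDelta < 0.00014 := by
  have hint := integral_gainNumerator
  have hth := arcsin_one_div_sqrt_three_bounds
  have h2 : Real.sqrt 2 < 1.41422 := (Real.sqrt_lt' (by norm_num)).2 (by norm_num)
  have h2' : 1.41421 < Real.sqrt 2 := Real.lt_sqrt_of_sq_lt (by norm_num)
  have hpi := Real.pi_gt_d4
  have hpi' := Real.pi_lt_d4
  constructor
  · have h : ∫ p in (1 / 2 : ℝ)..1, 1 / 45 * (gainNumerator p / Real.sqrt (p * (1 - p))) ≤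
        poincareDelta := by
      refine intervalIntegral.integral_mono_on (by norm_num)
        (intervalIntegrable_gainNumerator.const_mul _) intervalIntegrable_poincareIntegrand
        fun p hp => ?_
      rw [poincareIntegrand, ← mul_div_assoc]
      refine div_le_div_of_nonneg_right ?_ (Real.sqrt_nonneg _)
      have hu := mul_one_sub_cube_mem hp
      change 1 / 45 * gainNumerator p ≤ gainNumerator p / _
      rw [one_div_mul_eq_div]
      exact div_le_div_of_nonneg_left (gainNumerator_nonneg hp) (by linarith) (by linarith)
    rw [intervalIntegral.integral_const_mul, hint] at h
    linarith
  -- Since u ≤ 1/4, the denominator 45 - 3u³ is at least 45 - 3/64 > 44.95.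
  · have h : poincareDelta ≤
        ∫ p in (1 / 2 : ℝ)..1, 1 / 44.95 * (gainNumerator p / Real.sqrt (p * (1 - p))) := by
      refine intervalIntegral.integral_mono_on (by norm_num)
        intervalIntegrable_poincareIntegrand (intervalIntegrable_gainNumerator.const_mul _)
        fun p hp => ?_
      rw [poincareIntegrand, ← mul_div_assoc]
      refine div_le_div_of_nonneg_right ?_ (Real.sqrt_nonneg _)
      have hu := mul_one_sub_cube_mem hp
      change gainNumerator p / _ ≤ 1 / 44.95 * gainNumerator p
      rw [one_div_mul_eq_div]
      exact div_le_div_of_nonneg_left (gainNumerator_nonneg hp) (by norm_num) (by linarith)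
    rw [intervalIntegral.integral_const_mul, hint] at h
    linarith

/-! ### Interpolation between independence and equality -/

namespace Hypercube

/-- `𝔼 f(x) g(x ξ)` for `x` uniform and `ξ` with independent coordinates of bias `p`. -/
noncomputable def biasedCorrelation {n : ℕ} (f g : Hypercube n → ℝ) (p : ℝ) : ℝ :=
  mean fun x => f x * biasedMean p fun ξ => g (x * ξ)

theorem mean_mono {n : ℕ} {F G : Hypercube n → ℝ} (h : ∀ x, F x ≤ G x) : mean F ≤ mean G :=
  div_le_div_of_nonneg_right (Finset.sum_le_sum fun x _ => h x) (by positivity)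

theorem mean_const_mul {n : ℕ} (c : ℝ) (F : Hypercube n → ℝ) :
    mean (fun x => c * F x) = c * mean F := by
  rw [mean, mean, ← Finset.mul_sum, mul_div_assoc]

theorem biasedCorrelation_one {n : ℕ} (f g : Hypercube n → ℝ) :
    biasedCorrelation f g 1 = mean fun x => f x * g x := by
  unfold biasedCorrelation
  congr 1; ext x
  rw [biasedMean, Fintype.sum_eq_single 1]
  · simp [biasedWeight]
  · intro ξ hξ
    obtain ⟨i, hi⟩ := Function.ne_iff.1 hξ
    rw [Finset.prod_eq_zero (Finset.mem_univ i), zero_mul]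
    rcases Int.units_eq_one_or (ξ i) with h | h
    · exact absurd h hi
    · norm_num [biasedWeight, h]

theorem biasedCorrelation_half {n : ℕ} (f g : Hypercube n → ℝ) :
    biasedCorrelation f g (1 / 2) = mean f * mean g := by
  have h (x : Hypercube n) : biasedMean (1 / 2) (fun ξ => g (x * ξ)) = mean g := by
    rw [mean, ← Equiv.sum_comp (Equiv.mulLeft x) g, Finset.sum_div, biasedMean]
    refine Finset.sum_congr rfl fun ξ _ => ?_
    simp [biasedWeight]
    ring
  simp only [biasedCorrelation, h]
  rw [mul_comm (mean f), ← mean_const_mul]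
  simp only [mul_comm]

theorem continuous_biasedCorrelation {n : ℕ} (f g : Hypercube n → ℝ) :
    Continuous (biasedCorrelation f g) := by
  unfold biasedCorrelation mean biasedMean biasedWeight
  fun_prop

theorem hasDerivAt_biasedMean {n : ℕ} (F : Hypercube n → ℝ) (p : ℝ) :
    HasDerivAt (fun p => biasedMean p F)
      (∑ j, ∑ ξ : Hypercube n,
        (∏ i ∈ Finset.univ.erase j, biasedWeight p (ξ i)) * ((ξ j : ℤ) : ℝ) * F ξ) p := by
  rw [Finset.sum_comm]
  simp only [← Finset.sum_mul]
  refine HasDerivAt.fun_sum fun ξ _ => HasDerivAt.mul_const ?_ (F ξ)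
  simp only [← smul_eq_mul]
  refine HasDerivAt.fun_finsetProd fun i _ => ?_
  unfold biasedWeight
  have := (((((hasDerivAt_id p).const_mul 2).sub_const 1).mul_const ((ξ i : ℤ) : ℝ)).const_add
    1).div_const 2
  exact this.congr_deriv (by simp)

theorem flip_flip {n : ℕ} (j : Fin n) (x : Hypercube n) : flip j (flip j x) = x := by
  simp [flip]

/-- Reversing the sign of one coordinate, as a permutation. -/
def flipEquiv {n : ℕ} (j : Fin n) : Equiv.Perm (Hypercube n) where
  toFun := flip j
  invFun := flip j
  left_inv := flip_flip j
  right_inv := flip_flip j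

theorem flip_mul_flip {n : ℕ} (j : Fin n) (x ξ : Hypercube n) : flip j x * flip j ξ = x * ξ := by
  ext i
  by_cases h : i = j
  · subst h; simp [flip]
  · simp [flip, h]

/-- Only the part of f odd in the j-th coordinate, which is D_j f, pairs with an odd kernel. -/
theorem sum_mul_eq_sum_discreteDeriv_mul {n : ℕ} (j : Fin n) (f K : Hypercube n → ℝ)
    (hK : ∀ x, K (flip j x) = -K x) : ∑ x, f x * K x = ∑ x, discreteDeriv j f x * K x := by
  have h : ∑ x, f (flip j x) * K x = -∑ x, f x * K x := by
    rw [← Equiv.sum_comp (flipEquiv j), ← Finset.sum_neg_distrib]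
    refine Finset.sum_congr rfl fun x _ => ?_
    change f (flip j (flip j x)) * K (flip j x) = _
    rw [flip_flip, hK, mul_neg]
  have e : ∑ x, discreteDeriv j f x * K x =
      (∑ x, f x * K x - ∑ x, f (flip j x) * K x) / 2 := by
    rw [← Finset.sum_sub_distrib, Finset.sum_div]
    exact Finset.sum_congr rfl fun x _ => by rw [discreteDeriv]; ring
  rw [e, h]; ring

/-- The contribution of the `j`-th coordinate to the derivative of `𝔼 g(x ξ)` in the bias. -/
noncomputable def coordDeriv {n : ℕ} (p : ℝ) (g : Hypercube n → ℝ) (j : Fin n)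
    (x : Hypercube n) : ℝ :=
  ∑ ξ : Hypercube n,
    (∏ i ∈ Finset.univ.erase j, biasedWeight p (ξ i)) * ((ξ j : ℤ) : ℝ) * g (x * ξ)

/-- Flipping coordinate j of both x and ξ preserves xξ and the remaining weights, but changes the
sign of ξ_j. -/
theorem coordDeriv_flip {n : ℕ} (p : ℝ) (g : Hypercube n → ℝ) (j : Fin n) (x : Hypercube n) :
    coordDeriv p g j (flip j x) = -coordDeriv p g j x := by
  rw [coordDeriv, coordDeriv, ← Equiv.sum_comp (flipEquiv j), ← Finset.sum_neg_distrib]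
  refine Finset.sum_congr rfl fun ξ _ => ?_
  change (∏ i ∈ Finset.univ.erase j, biasedWeight p (flip j ξ i)) * ((flip j ξ j : ℤ) : ℝ) *
    g (flip j x * flip j ξ) = _
  rw [flip_mul_flip]
  have h : ∏ i ∈ Finset.univ.erase j, biasedWeight p (flip j ξ i) =
      ∏ i ∈ Finset.univ.erase j, biasedWeight p (ξ i) :=
    Finset.prod_congr rfl fun i hi => by simp [flip, (Finset.mem_erase.1 hi).1]
  rw [h]
  simp [flip]

theorem biasedWeight_mul_centred (p : ℝ) (s : ℤˣ) :
    biasedWeight p s * centred p s = p * (1 - p) * ((s : ℤ) : ℝ) := by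
  rcases Int.units_eq_one_or s with rfl | rfl <;>
    simp only [biasedWeight, centred, Units.val_one, Units.val_neg, Int.cast_one, Int.cast_neg] <;>
    ring

/-- The p-derivative s of the weight equals the weight times `centred p s` / u, the score of the
biased sign; this restores the missing factor of the product measure. -/
theorem mul_coordDeriv {n : ℕ} (p : ℝ) (g : Hypercube n → ℝ) (j : Fin n) (x : Hypercube n) :
    p * (1 - p) * coordDeriv p g j x = biasedMean p fun ξ => centred p (ξ j) * g (x * ξ) := by
  rw [coordDeriv, Finset.mul_sum, biasedMean]
  refine Finset.sum_congr rfl fun ξ _ => ?_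
  rw [← Finset.prod_erase_mul _ _ (Finset.mem_univ j)]
  linear_combination -(∏ i ∈ Finset.univ.erase j, biasedWeight p (ξ i)) * g (x * ξ) *
    biasedWeight_mul_centred p (ξ j)

theorem hasDerivAt_biasedCorrelation {n : ℕ} (f g : Hypercube n → ℝ) (p : ℝ) :
    HasDerivAt (biasedCorrelation f g)
      (mean fun x => ∑ j, discreteDeriv j f x * coordDeriv p g j x) p := by
  have h : HasDerivAt (biasedCorrelation f g)
      (mean fun x => f x * ∑ j, coordDeriv p g j x) p :=
    (HasDerivAt.fun_sum fun x _ => (hasDerivAt_biasedMean _ p).const_mul (f x)).div_const _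
  refine h.congr_deriv ?_
  simp only [mean, Finset.mul_sum]
  rw [Finset.sum_comm]
  simp only [sum_mul_eq_sum_discreteDeriv_mul _ f _ (coordDeriv_flip p g _)]
  rw [Finset.sum_comm]

theorem sum_discreteDeriv_mul_coordDeriv_le {n : ℕ} (f g : Hypercube n → ℝ)
    (hg : ∀ x, |g x| ≤ 1) {p : ℝ} (hp : p ∈ Set.Ioo (1 / 2 : ℝ) 1) (x : Hypercube n) :
    ∑ j, discreteDeriv j f x * coordDeriv p g j x ≤
      (1 - biasedGain p) / Real.sqrt (p * (1 - p)) * gradNorm f x := by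
  have hr := sqrt_mul_one_sub_pos hp
  have hu0 : 0 < p * (1 - p) := Real.sqrt_pos.1 hr
  have h : p * (1 - p) * ∑ j, discreteDeriv j f x * coordDeriv p g j x =
      biasedMean p fun ξ => linearForm p (fun j => discreteDeriv j f x) ξ * g (x * ξ) := by
    simp only [Finset.mul_sum, linearForm, Finset.sum_mul, biasedMean]
    rw [Finset.sum_comm]
    refine Finset.sum_congr rfl fun j _ => ?_
    rw [mul_left_comm, mul_coordDeriv, biasedMean, Finset.mul_sum]
    exact Finset.sum_congr rfl fun ξ _ => by ring
  have h' : (biasedMean p fun ξ => linearForm p (fun j => discreteDeriv j f x) ξ * g (x * ξ)) ≤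
      (1 - biasedGain p) * Real.sqrt (p * (1 - p)) * gradNorm f x := by
    refine (biasedMean_mono (by linarith [hp.1]) hp.2.le fun ξ => ?_).trans
      ((biasedMean_abs_linearForm_le hp.1 hp.2 fun j => discreteDeriv j f x).trans_eq
        (by simp only [gradNorm, sq_abs]))
    refine (le_abs_self _).trans ?_
    rw [abs_mul]
    exact mul_le_of_le_one_right (abs_nonneg _) (hg _)
  rw [← h] at h'
  have e : (1 - biasedGain p) * Real.sqrt (p * (1 - p)) * gradNorm f x =
      p * (1 - p) * ((1 - biasedGain p) / Real.sqrt (p * (1 - p)) * gradNorm f x) := by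
    have hr2 := Real.sq_sqrt hu0.le
    generalize Real.sqrt (p * (1 - p)) = r at *
    field_simp
    rw [hr2]
    ring
  rw [e] at h'
  exact le_of_mul_le_mul_left h' hu0

theorem mean_mul_sub_mean_mul_mean_le {n : ℕ} (f g : Hypercube n → ℝ) (hg : ∀ x, |g x| ≤ 1) :
    mean (fun x => f x * g x) - mean f * mean g ≤
      (Real.pi / 2 - poincareDelta) * mean (gradNorm f) := by
  have hint : IntervalIntegrable
      (fun p => (1 / Real.sqrt (p * (1 - p)) - poincareIntegrand p) * mean (gradNorm f))
      MeasureTheory.volume (1 / 2) 1 :=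
    (intervalIntegrable_one_div_sqrt.sub intervalIntegrable_poincareIntegrand).mul_const _
  -- The bound on the derivative is needed only on the open interval, with continuity of the
  -- correlation at the ends, so its integrable blow-up at p = 1 is harmless.
  have h := intervalIntegral.sub_le_integral_of_hasDeriv_right_of_le (by norm_num)
    (continuous_biasedCorrelation f g).continuousOn
    (fun p _ => (hasDerivAt_biasedCorrelation f g p).hasDerivWithinAt)
    ((intervalIntegrable_iff_integrableOn_Icc_of_le (by norm_num)).1 hint) fun p hp => by
      refine (mean_mono fun x => sum_discreteDeriv_mul_coordDeriv_le f g hg hp x).trans_eq ?_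
      rw [mean_const_mul, sub_div, poincareIntegrand]
  rwa [biasedCorrelation_one, biasedCorrelation_half, intervalIntegral.integral_mul_const,
    intervalIntegral.integral_sub intervalIntegrable_one_div_sqrt
      intervalIntegrable_poincareIntegrand, integral_one_div_sqrt] at h

theorem mean_abs_sub_mean_le {n : ℕ} (f : Hypercube n → ℝ) :
    mean (fun x => |f x - mean f|) ≤
      (Real.pi / 2 - poincareDelta) * mean (gradNorm f) := by
  refine le_trans (le_of_eq ?_) (mean_mul_sub_mean_mul_mean_le f
    (fun x => (SignType.sign (f x - mean f) : ℝ)) fun x => ?_)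
  · rw [← mean_const_mul]
    simp only [mean]
    rw [← sub_div, ← Finset.sum_sub_distrib]
    congr 1
    refine Finset.sum_congr rfl fun x _ => ?_
    rw [← sub_mul, self_mul_sign]
  · rcases lt_trichotomy (f x - mean f) 0 with h | h | h <;> simp [h]

end Hypercube

theorem mainTheorem3 :
    IntervalIntegrable poincareIntegrand MeasureTheory.volume (1 / 2 : ℝ) 1 ∧
    (0.00013 : ℝ) ≤ poincareDelta ∧ poincareDelta < (0.00014 : ℝ) ∧
    ∀ (n : ℕ) (f : Hypercube n → ℝ),
      Hypercube.mean (fun x => |f x - Hypercube.mean f|) ≤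
        (Real.pi / 2 - poincareDelta) * Hypercube.mean (Hypercube.gradNorm f) :=
  ⟨intervalIntegrable_poincareIntegrand, poincareDelta_bounds.1, poincareDelta_bounds.2,
    fun _ f => Hypercube.mean_abs_sub_mean_le f⟩
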